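/- All rings are associative with $1$ and modules are unital. A ring $A$ is called right dual Kasch if every simple right $A$-module is a homomorphic image of an injective right $A$-module. Let $R$ be a ring and let $G$ be a finite group acting on $R$ by ring automorphisms, where the action of $g \in G$ on $a \in R$ is written $g \cdot a$. The skew group ring $R*G$ is the free left $R$-module with basis $\{\overline{g} : g \in G\}$ and with multiplication determined by $(a\overline{g})(b\overline{h}) = a\,(g\cdot b)\,\overline{gh}$ for all $a,b\in R$ and $g,h\in G$. Proposition. If $|G|$ is invertible in $R$ and $R$ is right dual Kasch, then $R*G$ is right dual Kasch. -/

import Mathlib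

universe u v

/-- A ring `R` is right dual Kasch if every simple right `R`-module is a homomorphic image of an
injective right `R`-module. Right `R`-modules are modules over `Rᵐᵒᵖ`. Simple modules are cyclic,
so each of them has a copy in the universe of `R`, and the same holds for injective modules
needed here, since the injective hull of `R` lives in that universe. -/
def IsRightDualKasch (R : Type u) [Ring R] : Prop :=
  ∀ (S : Type u) [AddCommGroup S] [Module Rᵐᵒᵖ S], IsSimpleModule Rᵐᵒᵖ S →
    ∃ (E : Type u) (_ : AddCommGroup E) (_ : Module Rᵐᵒᵖ E),
      Module.Injective Rᵐᵒᵖ E ∧ ∃ f : E →ₗ[Rᵐᵒᵖ] S, Function.Surjective f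

/-- The skew group ring `R * G` of a ring `R` on which the group `G` acts by ring automorphisms:
the free left `R`-module on basis elements `single g 1`, `g : G`, with the multiplication
`single g a * single h b = single (g * h) (a * g • b)`. -/
abbrev SkewGroupRing (R : Type u) (G : Type v) [Ring R] [Group G] [MulSemiringAction G R] :
    Type (max u v) :=
  SkewMonoidAlgebra R G

namespace SkewGroupRing

section Clifford

variable {A : Type*} {M : Type*} {G : Type*} [Ring A] [AddCommGroup M] [Module A M] [Group G]
  [DistribMulAction G M]

/-! Put `A = Rᵐᵒᵖ`, `B = (R * G)ᵐᵒᵖ`, and let `S` be a simple `B`-module. By Clifford's argument `S`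
is semisimple over `A`, so it has a simple submodule `U`, covered by an injective `E`. The
`B`-module `Hom_A(B, E)` is injective, and summing over `G` turns `p : E → U ⊆ S` into a `B`-linear
map `Hom_A(B, E) → S`. It is nonzero, hence onto because `S` is simple. -/

/-- The preimage of a submodule under the action of a group element that permutes scalars. -/
def translate (hG : ∀ (g : G) (a : A), ∃ a' : A, ∀ x : M, g • a • x = a' • g • x)
    (g : G) (N : Submodule A M) : Submodule A M where
  carrier := {x | g • x ∈ N}
  add_mem' hx hy := by
    simpa only [Set.mem_ofPred_eq, smul_add] using N.add_mem hx hy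
  zero_mem' := by simp
  smul_mem' a x hx := by
    obtain ⟨a', ha'⟩ := hG g a
    simpa only [Set.mem_ofPred_eq, ha' x] using N.smul_mem a' hx

theorem mem_translate {hG : ∀ (g : G) (a : A), ∃ a' : A, ∀ x : M, g • a • x = a' • g • x}
    {g : G} {N : Submodule A M} {x : M} : x ∈ translate hG g N ↔ g • x ∈ N :=
  Iff.rfl

/-- Translation by a group element as an automorphism of the lattice of submodules. -/
def translateOrderIso (hG : ∀ (g : G) (a : A), ∃ a' : A, ∀ x : M, g • a • x = a' • g • x)
    (g : G) : Submodule A M ≃o Submodule A M where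
  toFun := translate hG g
  invFun := translate hG g⁻¹
  left_inv N := by ext x; simp [mem_translate]
  right_inv N := by ext x; simp [mem_translate]
  map_rel_iff' {N P} := by
    refine ⟨fun h x hx => ?_, fun h x hx => h hx⟩
    have := @h (g⁻¹ • x) (by simpa [mem_translate] using hx)
    simpa [mem_translate] using this

/-- Clifford's theorem: a finitely generated module with a semilinear action of a finite group
and without proper nonzero stable submodules is semisimple. -/
theorem isSemisimpleModule_of_stable [Finite G] [Module.Finite A M] [Nontrivial M]
    (hG : ∀ (g : G) (a : A), ∃ a' : A, ∀ x : M, g • a • x = a' • g • x)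
    (hM : ∀ N : Submodule A M, (∀ (g : G), ∀ x ∈ N, g • x ∈ N) → N = ⊥ ∨ N = ⊤) :
    IsSemisimpleModule A M := by
  obtain ⟨N, hN, -⟩ := (eq_top_or_exists_le_coatom (⊥ : Submodule A M)).resolve_left bot_ne_top
  have simple (g : G) : IsSimpleModule A (M ⧸ translate hG g N) :=
    isSimpleModule_iff_isCoatom.2 (((translateOrderIso hG g).isCoatom_iff N).2 hN)
  -- The intersection of all translates is stable and proper, so `M` embeds in a finite product of
  -- simple quotients.
  have hcore : ⨅ g, translate hG g N = ⊥ := by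
    refine (hM _ fun g x hx => ?_).resolve_right fun h => hN.1 ?_
    · simp only [Submodule.mem_iInf, mem_translate] at hx ⊢
      intro k
      simpa [mul_smul] using hx (k * g)
    · rw [eq_top_iff, ← h]
      intro x hx
      simpa [mem_translate] using (Submodule.mem_iInf _).1 hx 1
  refine IsSemisimpleModule.of_injective
    (LinearMap.pi fun g => (translate hG g N).mkQ) (LinearMap.ker_eq_bot.1 ?_)
  rw [LinearMap.ker_pi]
  simpa using hcore

end Clifford

section Coinduced

variable (A : Type*) (B : Type*) (E : Type*) [Ring A] [Ring B] [Module A B] [IsScalarTower A B B]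
  [AddCommGroup E] [Module A E]

/-- The coinduced module structure on `A`-linear maps `B → E`. -/
@[reducible] def coinducedModule : Module B (B →ₗ[A] E) where
  smul b φ := φ ∘ₗ (LinearMap.toSpanSingleton B B b).restrictScalars A
  one_smul φ := LinearMap.ext fun x => congrArg φ (mul_one x)
  mul_smul b c φ := LinearMap.ext fun x => congrArg φ (mul_assoc x b c).symm
  smul_zero _ := rfl
  smul_add _ _ _ := rfl
  add_smul b c φ := LinearMap.ext fun x => (congrArg φ (mul_add x b c)).trans (map_add φ _ _)
  zero_smul φ := LinearMap.ext fun x => (congrArg φ (mul_zero x)).trans (map_zero φ)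

attribute [local instance] coinducedModule

theorem coinduced_smul_apply (b : B) (φ : B →ₗ[A] E) (x : B) : (b • φ) x = φ (x * b) :=
  rfl

end Coinduced

attribute [local instance] coinducedModule

/-- Modules coinduced from injective modules are injective. -/
theorem injective_coinduced (A : Type u) (B : Type (max u v)) (E : Type u) [Ring A] [Ring B]
    [Module A B] [IsScalarTower A B B] [AddCommGroup E] [Module A E] [Module.Injective A E] :
    Module.Injective B (B →ₗ[A] E) := by
  refine Module.Baer.injective fun I g => ?_
  -- Baer's criterion via the adjunction: evaluate at `1`, extend over `A` to `h`, return by `b ↦ b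
  -- • h`.
  let g₁ : I →ₗ[A] E :=
    { toFun := fun x => g x 1
      map_add' := fun x y => by simp
      map_smul' := fun a x => by
        have h : a • x = (a • (1 : B)) • x := by simp
        rw [h, map_smul, coinduced_smul_apply]
        simp }
  obtain ⟨h, hh⟩ := Module.Injective.extension_property A E I B
    (I.subtype.restrictScalars A) I.injective_subtype g₁
  refine ⟨{ toFun := fun b => b • h
            map_add' := fun b c => add_smul b c h
            map_smul' := fun b c => mul_smul b c h }, fun x hx => LinearMap.ext fun y => ?_⟩
  have h1 := LinearMap.congr_fun hh (y • ⟨x, hx⟩ : I)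
  change h (y * x) = g (y • ⟨x, hx⟩) 1 at h1
  rw [map_smul, coinduced_smul_apply, one_mul] at h1
  exact h1

section CrossedProduct

variable {A B S E G : Type*} [Ring A] [Ring B] [Module A B]
  [AddCommGroup S] [Module B S] [Module A S] [IsScalarTower A B S]
  [AddCommGroup E] [Module A E] [Group G] (w : G →* B)

/-- The finite sum `∑ g, w g • p (φ (w g⁻¹))`, which is `B`-linear in `φ` when `B` is spanned over
`A` by the normalizing units `w g`. -/
def coinducedLift [IsScalarTower A B B] [Fintype G]
    (hw : ∀ (g : G) (a : A), ∃ a' : A, w g * a • 1 = a' • w g)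
    (hspan : Submodule.span A (Set.range w) = ⊤) (p : E →ₗ[A] S) : (B →ₗ[A] E) →ₗ[B] S where
  toFun φ := ∑ g, w g • p (φ (w g⁻¹))
  map_add' φ ψ := by simp [Finset.sum_add_distrib]
  map_smul' b φ := by
    simp only [coinduced_smul_apply, RingHom.id_apply]
    have hb : b ∈ Submodule.span A (Set.range w) := hspan ▸ Submodule.mem_top
    induction hb using Submodule.span_induction generalizing φ with
    | mem b hb =>
      obtain ⟨h, rfl⟩ := hb
      rw [Finset.smul_sum, ← Equiv.sum_comp (Equiv.mulLeft h)]
      simp [← map_mul, ← mul_smul]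
    | zero => simp
    | add b c _ _ ihb ihc => simp [mul_add, Finset.sum_add_distrib, ihb, ihc, add_smul]
    | smul a b _ ih =>
      -- The scalar is twisted on passing `w g⁻¹` and untwisted on passing `w g`.
      have h (g : G) : w g • p (φ (w g⁻¹ * a • b)) = a • w g • p (φ (w g⁻¹ * b)) := by
        obtain ⟨a', ha'⟩ := hw g⁻¹ a
        have h1 : w g⁻¹ * a • b = a' • (w g⁻¹ * b) := by
          rw [← smul_mul_assoc, ← ha', mul_assoc, smul_mul_assoc, one_mul]
        have h2 : w g * a' • 1 = a • w g := by
          calc w g * a' • 1 = w g * (a' • w g⁻¹) * w g := by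
                rw [mul_assoc, smul_mul_assoc, ← map_mul, inv_mul_cancel, map_one]
            _ = a • w g := by
                rw [← ha', ← mul_assoc, ← map_mul, mul_inv_cancel, map_one, one_mul,
                  smul_mul_assoc, one_mul]
        rw [h1, map_smul, map_smul, ← smul_assoc a (w g), ← h2, mul_smul, smul_assoc, one_smul]
      simp only [h, ← Finset.smul_sum, ih, smul_assoc]

theorem coinducedLift_apply [IsScalarTower A B B] [Fintype G]
    (hw : ∀ (g : G) (a : A), ∃ a' : A, w g * a • 1 = a' • w g)
    (hspan : Submodule.span A (Set.range w) = ⊤) (p : E →ₗ[A] S) (φ : B →ₗ[A] E) :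
    coinducedLift w hw hspan p φ = ∑ g, w g • p (φ (w g⁻¹)) :=
  rfl

/-- A simple `B`-module is semisimple over `A`. -/
theorem isSemisimpleModule_of_isSimpleModule [Finite G] [IsSimpleModule B S]
    (hw : ∀ (g : G) (a : A), ∃ a' : A, w g * a • 1 = a' • w g)
    (hspan : Submodule.span A (Set.range w) = ⊤) : IsSemisimpleModule A S := by
  have : Module.Finite A B := ⟨⟨(Set.finite_range w).toFinset, by simpa using hspan⟩⟩
  have : Module.Finite A S := Module.Finite.trans B S
  have : Nontrivial S := IsSimpleModule.nontrivial B S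
  let _ : DistribMulAction G S := DistribMulAction.compHom S w
  have hsmul (g : G) (x : S) : g • x = w g • x := rfl
  refine isSemisimpleModule_of_stable (A := A) (G := G) (fun g a => ?_) fun N hN => ?_
  · obtain ⟨a', ha'⟩ := hw g a
    refine ⟨a', fun x => ?_⟩
    rw [hsmul, hsmul, ← smul_assoc a', ← ha', mul_smul, smul_assoc, one_smul]
  · let N' : Submodule B S :=
      { N with
        smul_mem' := fun b x hx => by
          have hb : b ∈ Submodule.span A (Set.range w) := hspan ▸ Submodule.mem_top
          change b • x ∈ N
          induction hb using Submodule.span_induction with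
          | mem b hb =>
            obtain ⟨h, rfl⟩ := hb
            exact hN h x hx
          | zero => simp
          | add b c _ _ ihb ihc => simpa [add_smul] using N.add_mem ihb ihc
          | smul a b _ ih => simpa using N.smul_mem a ih }
    have hmem (x : S) : x ∈ N' ↔ x ∈ N := Iff.rfl
    refine (eq_bot_or_eq_top N').imp (fun h => ?_) fun h => ?_ <;>
    · ext x
      rw [← hmem, h]
      simp

/-- Coinducing an injective cover of a simple `A`-submodule gives an injective `B`-module mapping
onto a simple `B`-module. -/
theorem exists_injective_surjective {A : Type u} {B S : Type (max u v)} {G : Type*}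
    [Ring A] [Ring B] [AddCommGroup S] [Module B S] [Group G] [Finite G]
    [IsSimpleModule B S] (f : A →+* B) (w : G →* B)
    (hw : ∀ (g : G) (a : A), ∃ a' : A, w g * f a = f a' * w g)
    (hspan : AddSubmonoid.closure {b | ∃ a g, b = f a * w g} = ⊤)
    (ε : B →+ A) (hε_mul : ∀ a b, ε (f a * b) = a * ε b)
    (hε_one : ε 1 = 1) (hε : ∀ g, g ≠ 1 → ε (w g) = 0)
    (hA : ∀ (U : Type u) [AddCommGroup U] [Module A U], IsSimpleModule A U →
      ∃ (E : Type u) (_ : AddCommGroup E) (_ : Module A E),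
        Module.Injective A E ∧ ∃ f : E →ₗ[A] U, Function.Surjective f) :
    ∃ (E : Type (max u v)) (_ : AddCommGroup E) (_ : Module B E),
      Module.Injective B E ∧ ∃ f : E →ₗ[B] S, Function.Surjective f := by
  have := Fintype.ofFinite G
  have : Nontrivial S := IsSimpleModule.nontrivial B S
  let _ : Module A B := Module.compHom B f
  let _ : Module A S := Module.compHom S f
  have hsmul (a : A) (b : B) : a • b = f a * b := rfl
  have : IsScalarTower A B B := ⟨fun a b c => mul_assoc (f a) b c⟩
  have : IsScalarTower A B S := ⟨fun a b x => mul_smul (f a) b x⟩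
  replace hw (g : G) (a : A) : ∃ a' : A, w g * a • 1 = a' • w g := by
    simpa [hsmul] using hw g a
  replace hspan : Submodule.span A (Set.range w) = ⊤ := by
    refine eq_top_iff.2 fun b _ => ?_
    have hb : b ∈ AddSubmonoid.closure {b | ∃ a g, b = f a * w g} := hspan ▸ AddSubmonoid.mem_top b
    refine (AddSubmonoid.closure_le (S := (Submodule.span A (Set.range w)).toAddSubmonoid)).2 ?_ hb
    rintro _ ⟨a, g, rfl⟩
    exact Submodule.smul_mem _ a (Submodule.subset_span ⟨g, rfl⟩)
  let ε' : B →ₗ[A] A := { ε with map_smul' := hε_mul }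
  have hε' (b : B) : ε' b = ε b := rfl
  have := isSemisimpleModule_of_isSimpleModule (A := A) (S := S) w hw hspan
  obtain ⟨U, hU⟩ := IsSemisimpleModule.exists_simple_submodule A S
  -- `U` lies in a larger universe than `hA` allows; its copy `A ⧸ I` does not.
  obtain ⟨I, hI, ⟨e⟩⟩ := isSimpleModule_iff_quot_maximal.1 hU
  obtain ⟨E, _, _, hE, q, hq⟩ := hA (A ⧸ I) (IsSimpleModule.congr e.symm)
  let p : E →ₗ[A] S := U.subtype ∘ₗ e.symm.toLinearMap ∘ₗ q
  have := IsSimpleModule.nontrivial A U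
  obtain ⟨y, hy⟩ := exists_ne (0 : U)
  obtain ⟨x, hx⟩ := hq (e y)
  have hp : p x ≠ 0 := by simpa [p, hx] using hy
  refine ⟨B →ₗ[A] E, inferInstance, inferInstance, injective_coinduced A B E,
    coinducedLift w hw hspan p, ?_⟩
  refine LinearMap.surjective_of_ne_zero fun h => hp ?_
  -- On `b ↦ ε b • x` only the term `g = 1` survives, with value `p x`.
  have h1 := LinearMap.congr_fun h (LinearMap.toSpanSingleton A E x ∘ₗ ε')
  rw [coinducedLift_apply, Finset.sum_eq_single 1 (fun g _ hg => by simp [hε', hε g⁻¹ (by simpa)])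
    (by simp)] at h1
  simpa [hε', hε_one] using h1

end CrossedProduct

end SkewGroupRing

open MulOpposite SkewMonoidAlgebra in
theorem mainTheorem4 (R : Type u) [Ring R] (G : Type v) [Group G] [Finite G]
    [MulSemiringAction G R] (hG : IsUnit (Nat.card G : R)) (hR : IsRightDualKasch R) :
    IsRightDualKasch (SkewGroupRing R G) := by
  intro S _ _ hS
  let i : R →+* SkewGroupRing R G :=
    { toFun := single 1
      map_one' := rfl
      map_mul' := fun a b => by simp [single_mul_single]
      map_zero' := by simp
      map_add' := fun a b => by simp [single_add] }
  -- The inverse offsets the order reversal in the opposite ring.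
  let w : G →* (SkewGroupRing R G)ᵐᵒᵖ :=
    { toFun := fun g => op (single g⁻¹ 1)
      map_one' := by simp
      map_mul' := fun g h => by rw [← op_mul]; simp [single_mul_single] }
  have hi (a : Rᵐᵒᵖ) : i.op a = op (single 1 (unop a)) := rfl
  have hw (g : G) : w g = op (single g⁻¹ 1) := rfl
  refine SkewGroupRing.exists_injective_surjective.{u, v} i.op w (fun g a => ?_) ?_
    { toFun := fun b => op ((unop b).coeff 1)
      map_zero' := by simp
      map_add' := fun b c => by simp } (fun a b => ?_) (by simp)
    (fun g hg => by simp [hw, hg]) hR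
  · refine ⟨op (g • unop a), ?_⟩
    rw [hi, hi, hw, ← op_mul, ← op_mul]
    simp [single_mul_single]
  · refine eq_top_iff.2 fun b _ => ?_
    induction b using MulOpposite.rec' with
    | h b =>
    induction b using SkewMonoidAlgebra.induction_on with
    | zero => exact zero_mem _
    | single g a =>
      -- `single g a = single g 1 * single 1 (g⁻¹ • a)`.
      refine AddSubmonoid.subset_closure ⟨op (g⁻¹ • a), g⁻¹, ?_⟩
      rw [hi, hw, ← op_mul]
      simp [single_mul_single]
    | add b c hb hc => exact add_mem (hb trivial) (hc trivial)
  · have h : unop (i.op a * b) = unop b * single 1 (unop a) := rfl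
    rw [AddMonoidHom.coe_mk, ZeroHom.coe_mk, h, coeff_mul_single_one, one_smul]
    rfl
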